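/- Let $\mu$ be the Möbius function ($\mu(1)=1$, $\mu(n)=(-1)^m$ if $n$ is a product of $m$ distinct primes, and $\mu(n)=0$ if $n$ is divisible by the square of a prime). Then the series $m_\infty=\sum_{k=1}^{\infty}\frac{\mu(k)}{k}$, understood as the limit of the partial sums $m_N=\sum_{k=1}^{N}\frac{\mu(k)}{k}$ as $N\to\infty$, converges; the infinite product $\prod_{p}\left(1-\frac1p\right)$ over all primes $p$, understood as the limit of its finite partial products, exists and equals $0$; and $$m_\infty=\sum_{k=1}^{\infty}\frac{\mu(k)}{k}=\prod_{p\ \text{prime}}\left(1-\frac1p\right)=0 .$$ -/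

import Mathlib

open Filter Topology

open MeasureTheory FourierTransform

/-! Put B(u) = m_⌊e^u⌋. Its Laplace transform is 1/(s ζ(s+1)) for Re s > 0; this extends
continuously to Re s ≥ 0, because s cancels the pole of ζ at 1 and ζ has no zeros on Re = 1. B is
also bounded and slowly oscillating, so the Tauberian theorem `tendsto_zero_of_laplace_continuousOn`
forces B → 0: smoothed averages of B vanish by Riemann–Lebesgue, and slow oscillation removes the
smoothing. The product vanishes because ∑ 1/p diverges. -/

/-! ### A Tauberian theorem by Fourier analysis -/

theorem integrable_exp_neg_smul_of_bounded {B : ℝ → ℂ} {C : ℝ} (hBm : Measurable B)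
    (hB : ∀ x, ‖B x‖ ≤ C) (hB0 : ∀ x < 0, B x = 0) {σ : ℝ} (hσ : 0 < σ) :
    Integrable (fun u : ℝ => Real.exp (-σ * u) • B u) := by
  have hi : Integrable ((Set.Ici (0 : ℝ)).indicator fun u => Real.exp (-σ * u) * C) := by
    rw [integrable_indicator_iff measurableSet_Ici, integrableOn_Ici_iff_integrableOn_Ioi]
    exact (exp_neg_integrableOn_Ioi 0 hσ).mul_const C
  refine hi.mono' (by fun_prop) (Eventually.of_forall fun u => ?_)
  by_cases hu : 0 ≤ u
  · rw [Set.indicator_of_mem (by exact hu), norm_smul, Real.norm_of_nonneg (Real.exp_pos _).le]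
    gcongr
    exact hB u
  · simp [hB0 u (not_le.mp hu), hu]

theorem fourier_modulation (ψ : ℝ → ℂ) (x y : ℝ) :
    𝓕 (fun ξ : ℝ => Complex.exp (2 * Real.pi * ξ * y * Complex.I) * ψ ξ) x = 𝓕 ψ (x - y) := by
  simp only [Real.fourier_real_eq_integral_exp_smul, smul_eq_mul, ← mul_assoc, ← Complex.exp_add]
  congr 1 with ξ
  congr 2
  push_cast
  ring

theorem integral_mul_fourier_eq {f g : ℝ → ℂ} (hf : Integrable f) (hg : Integrable g) :
    ∫ ξ, 𝓕 f ξ * g ξ = ∫ x, f x * 𝓕 g x := by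
  simpa using! VectorFourier.integral_fourierIntegral_smul_eq_flip (L := innerₗ ℝ)
    (μ := volume) (ν := volume) Real.continuous_fourierChar continuous_inner hf hg

/-- The convolution of a bounded function with the Fourier transform of a compactly supported
function is the Fourier transform of the boundary values of its Laplace transform. -/
theorem integral_mul_fourier_sub_eq {B : ℝ → ℂ} {C : ℝ} (hBm : Measurable B)
    (hB : ∀ x, ‖B x‖ ≤ C) (hB0 : ∀ x < 0, B x = 0) {G : ℂ → ℂ}
    (hG : ContinuousOn G {s | 0 ≤ s.re})
    (hFG : ∀ σ : ℝ, 0 < σ → ∀ ξ : ℝ,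
      𝓕 (fun u : ℝ => Real.exp (-σ * u) • B u) ξ = G (σ + 2 * Real.pi * ξ * Complex.I))
    {ψ : ℝ → ℂ} (hψ : Continuous ψ) (hψc : HasCompactSupport ψ) (hK : Integrable (𝓕 ψ)) (y : ℝ) :
    ∫ x, B x * 𝓕 ψ (x - y) =
      𝓕 (fun ξ : ℝ => ψ ξ * G (2 * Real.pi * ξ * Complex.I)) (-y) := by
  set g : ℝ → ℂ := fun ξ => Complex.exp (2 * Real.pi * ξ * y * Complex.I) * ψ ξ with hgdef
  have hgc : Continuous g := by fun_prop
  have hgs : HasCompactSupport g := hψc.mul_left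
  have hgi : Integrable g := hgc.integrable_of_hasCompactSupport hgs
  -- Move the Fourier transform from ψ to the damped B, where it equals G; then let σ → 0+ on both
  -- sides.
  have key : ∀ σ : ℝ, 0 < σ → ∫ ξ : ℝ, G (σ + 2 * Real.pi * ξ * Complex.I) * g ξ =
      ∫ x, (Real.exp (-σ * x) • B x) * 𝓕 ψ (x - y) := by
    intro σ hσ
    have h := integral_mul_fourier_eq (integrable_exp_neg_smul_of_bounded hBm hB hB0 hσ) hgi
    simpa only [hFG σ hσ, hgdef, fourier_modulation] using h
  have hKy : Integrable fun x => 𝓕 ψ (x - y) := hK.comp_sub_right y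
  have lim1 : Tendsto (fun σ : ℝ => ∫ x, (Real.exp (-σ * x) • B x) * 𝓕 ψ (x - y)) (𝓝[>] 0)
      (𝓝 (∫ x, B x * 𝓕 ψ (x - y))) := by
    refine tendsto_integral_filter_of_dominated_convergence (fun x => C * ‖𝓕 ψ (x - y)‖) ?_ ?_
      (hKy.norm.const_mul C) ?_
    · refine Eventually.of_forall fun σ => ?_
      exact (by fun_prop : Measurable fun x => Real.exp (-σ * x) • B x).aestronglyMeasurable.mul
        hKy.aestronglyMeasurable
    · filter_upwards [self_mem_nhdsWithin] with σ hσ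
      refine Eventually.of_forall fun x => ?_
      rw [norm_mul, norm_smul]
      gcongr
      by_cases hx : x < 0
      · simpa [hB0 x hx] using (norm_nonneg _).trans (hB 0)
      · have hx' : 0 ≤ σ * x := mul_nonneg (le_of_lt hσ) (not_lt.mp hx)
        have : ‖Real.exp (-σ * x)‖ ≤ 1 := by
          rw [Real.norm_of_nonneg (Real.exp_pos _).le, Real.exp_le_one_iff]
          linarith
        calc _ ≤ 1 * ‖B x‖ := by gcongr
          _ ≤ C := by simpa using hB x
    · refine Eventually.of_forall fun x => ?_
      have : Tendsto (fun σ : ℝ => (Real.exp (-σ * x) • B x) * 𝓕 ψ (x - y)) (𝓝 0)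
          (𝓝 ((Real.exp (-0 * x) • B x) * 𝓕 ψ (x - y))) :=
        Continuous.tendsto (by fun_prop) 0
      simpa using this.mono_left nhdsWithin_le_nhds
  have lim2 : Tendsto (fun σ : ℝ => ∫ ξ : ℝ, G (σ + 2 * Real.pi * ξ * Complex.I) * g ξ) (𝓝[>] 0)
      (𝓝 (∫ ξ : ℝ, G (2 * Real.pi * ξ * Complex.I) * g ξ)) := by
    -- G is bounded on the compact set of points with 0 ≤ σ ≤ 1 and ξ in the support, which gives
    -- the dominating function.
    have hcomp : IsCompact ((fun p : ℝ × ℝ => (p.1 + 2 * Real.pi * p.2 * Complex.I : ℂ)) ''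
        (Set.Icc 0 1 ×ˢ tsupport g)) :=
      (isCompact_Icc.prod hgs).image (by fun_prop)
    obtain ⟨A, hA⟩ := hcomp.exists_bound_of_continuousOn (f := G) (hG.mono (by
      rintro _ ⟨⟨σ, ξ⟩, ⟨hσ, -⟩, rfl⟩
      simpa using hσ.1))
    have hline : ∀ σ : ℝ, 0 ≤ σ →
        Continuous fun ξ : ℝ => G (σ + 2 * Real.pi * ξ * Complex.I) := fun σ hσ =>
      hG.comp_continuous (by fun_prop) (by simpa using hσ)
    refine tendsto_integral_filter_of_dominated_convergence (fun ξ => A * ‖g ξ‖) ?_ ?_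
      (hgi.norm.const_mul A) ?_
    · filter_upwards [self_mem_nhdsWithin] with σ hσ
      exact ((hline σ (le_of_lt hσ)).mul hgc).aestronglyMeasurable
    · filter_upwards [Ioc_mem_nhdsGT (zero_lt_one' ℝ)] with σ hσ
      refine Eventually.of_forall fun ξ => ?_
      rw [norm_mul]
      by_cases hξ : ξ ∈ tsupport g
      · gcongr
        exact hA _ ⟨(σ, ξ), ⟨⟨hσ.1.le, hσ.2⟩, hξ⟩, rfl⟩
      · simp [image_eq_zero_of_notMem_tsupport hξ]
    · refine Eventually.of_forall fun ξ => Tendsto.mul_const _ ?_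
      have hmem : (2 * Real.pi * ξ * Complex.I : ℂ) ∈ {s : ℂ | 0 ≤ s.re} := by simp
      refine Tendsto.comp (hG _ hmem) (tendsto_nhdsWithin_iff.mpr ⟨?_, ?_⟩)
      · have : Tendsto (fun σ : ℝ => (σ + 2 * Real.pi * ξ * Complex.I : ℂ)) (𝓝 0)
          (𝓝 ((0 : ℝ) + 2 * Real.pi * ξ * Complex.I)) := Continuous.tendsto (by fun_prop) 0
        simpa using this.mono_left nhdsWithin_le_nhds
      · filter_upwards [self_mem_nhdsWithin] with σ hσ
        simpa using le_of_lt hσ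
  have heq := tendsto_nhds_unique lim1
    (lim2.congr' (by filter_upwards [self_mem_nhdsWithin] with σ hσ using key σ hσ))
  rw [heq, Real.fourier_real_eq_integral_exp_smul]
  congr 1 with ξ
  simp only [hgdef, smul_eq_mul]
  push_cast
  ring_nf

/-- Riemann–Lebesgue applied to the boundary values of G cut off by ψ. -/
theorem tendsto_integral_mul_fourier_sub {B : ℝ → ℂ} {C : ℝ} (hBm : Measurable B)
    (hB : ∀ x, ‖B x‖ ≤ C) (hB0 : ∀ x < 0, B x = 0) {G : ℂ → ℂ}
    (hG : ContinuousOn G {s | 0 ≤ s.re})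
    (hFG : ∀ σ : ℝ, 0 < σ → ∀ ξ : ℝ,
      𝓕 (fun u : ℝ => Real.exp (-σ * u) • B u) ξ = G (σ + 2 * Real.pi * ξ * Complex.I))
    {ψ : ℝ → ℂ} (hψ : Continuous ψ) (hψc : HasCompactSupport ψ) (hK : Integrable (𝓕 ψ)) :
    Tendsto (fun y => ∫ x, B x * 𝓕 ψ (x - y)) atTop (𝓝 0) := by
  simp only [integral_mul_fourier_sub_eq hBm hB hB0 hG hFG hψ hψc hK]
  refine (Real.zero_at_infty_fourier _).comp (tendsto_neg_atTop_atBot.mono_right ?_)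
  exact atBot_le_cocompact

/-- Dilating B by r concentrates the averaging kernel at scale 1/r; the Laplace hypothesis is stable
under dilation. -/
theorem tendsto_integral_comp_add_div_mul_fourier {B : ℝ → ℂ} {C : ℝ} (hBm : Measurable B)
    (hB : ∀ x, ‖B x‖ ≤ C) (hB0 : ∀ x < 0, B x = 0) {G : ℂ → ℂ}
    (hG : ContinuousOn G {s | 0 ≤ s.re})
    (hFG : ∀ σ : ℝ, 0 < σ → ∀ ξ : ℝ,
      𝓕 (fun u : ℝ => Real.exp (-σ * u) • B u) ξ = G (σ + 2 * Real.pi * ξ * Complex.I))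
    {ψ : ℝ → ℂ} (hψ : Continuous ψ) (hψc : HasCompactSupport ψ) (hK : Integrable (𝓕 ψ))
    {r : ℝ} (hr : 0 < r) :
    Tendsto (fun y => ∫ u, B (y + u / r) * 𝓕 ψ u) atTop (𝓝 0) := by
  have hscale : ∀ σ : ℝ, 0 < σ → ∀ ξ : ℝ,
      𝓕 (fun u : ℝ => Real.exp (-σ * u) • B (u / r)) ξ =
        r * G (r * (σ + 2 * Real.pi * ξ * Complex.I)) := by
    intro σ hσ ξ
    have h := hFG (r * σ) (by positivity) (r * ξ)
    have e : ((r * σ : ℝ) : ℂ) + 2 * Real.pi * ((r * ξ : ℝ) : ℂ) * Complex.I =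
        r * (σ + 2 * Real.pi * ξ * Complex.I) := by push_cast; ring
    rw [← e, ← h, Real.fourier_real_eq_integral_exp_smul, Real.fourier_real_eq_integral_exp_smul]
    have := Measure.integral_comp_div (fun v : ℝ =>
      Complex.exp (↑(-2 * Real.pi * v * (r * ξ)) * Complex.I) •
        (Real.exp (-(r * σ) * v) • B v)) r
    rw [abs_of_pos hr, Complex.real_smul] at this
    rw [← this]
    congr 1 with u
    have e1 : -2 * Real.pi * (u / r) * (r * ξ) = -2 * Real.pi * u * ξ := by field_simp
    have e2 : -(r * σ) * (u / r) = -σ * u := by field_simp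
    rw [e1, e2]
  have h := tendsto_integral_mul_fourier_sub (B := fun x => B (x / r)) (by fun_prop)
    (fun x => hB _) (fun x hx => hB0 _ (div_neg_of_neg_of_pos hx hr))
    (G := fun s => r * G (r * s)) (continuousOn_const.mul (hG.comp (by fun_prop) (by
      intro s hs
      simpa using mul_nonneg hr.le hs))) hscale hψ hψc hK
  refine (h.comp (tendsto_id.const_mul_atTop hr)).congr fun y => ?_
  simp only [Function.comp_apply, id]
  rw [← integral_add_right_eq_self (fun x => B (x / r) * 𝓕 ψ (x - r * y)) (r * y)]
  refine integral_congr_ae (Eventually.of_forall fun u => ?_)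
  simp only [add_sub_cancel_right]
  rw [add_div, mul_div_cancel_left₀ _ hr.ne', add_comm]

theorem exists_schwartz_hasCompactSupport_apply_zero_eq_one :
    ∃ ψ : SchwartzMap ℝ ℂ, HasCompactSupport ψ ∧ ψ 0 = 1 := by
  let b : ContDiffBump (0 : ℝ) := ⟨1, 2, one_pos, one_lt_two⟩
  have hc : HasCompactSupport fun x => (b x : ℂ) :=
    b.hasCompactSupport.comp_left (g := ((↑) : ℝ → ℂ)) Complex.ofReal_zero
  refine ⟨hc.toSchwartzMap (Complex.ofRealCLM.contDiff.comp b.contDiff), hc, ?_⟩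
  change ((b 0 : ℝ) : ℂ) = 1
  rw [b.one_of_mem_closedBall (by simp [b.rIn_pos.le])]
  simp

/-- A bounded slowly oscillating function whose Laplace transform extends continuously to the
closed right half-plane tends to zero. -/
theorem tendsto_zero_of_laplace_continuousOn {B : ℝ → ℂ} {C : ℝ} (hBm : Measurable B)
    (hB : ∀ x, ‖B x‖ ≤ C) (hB0 : ∀ x < 0, B x = 0) {G : ℂ → ℂ}
    (hG : ContinuousOn G {s | 0 ≤ s.re})
    (hFG : ∀ σ : ℝ, 0 < σ → ∀ ξ : ℝ,
      𝓕 (fun u : ℝ => Real.exp (-σ * u) • B u) ξ = G (σ + 2 * Real.pi * ξ * Complex.I))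
    {D : ℝ} (hD : 0 ≤ D) {ε : ℝ → ℝ} (hε : Tendsto ε atTop (𝓝 0))
    (hosc : ∀ᶠ y in atTop, ∀ z, ‖B y - B z‖ ≤ D * |y - z| + ε y) :
    Tendsto B atTop (𝓝 0) := by
  obtain ⟨ψ, hψc, hψ0⟩ := exists_schwartz_hasCompactSupport_apply_zero_eq_one
  set K : SchwartzMap ℝ ℂ := 𝓕 ψ with hKdef
  have hKcoe : 𝓕 (ψ : ℝ → ℂ) = K := (SchwartzMap.fourier_coe ψ).symm
  have hKi : Integrable K := K.integrable
  have hK1 : Integrable fun u => |u| * ‖K u‖ := by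
    simpa using K.integrable_pow_mul volume 1
  have hint : ∫ u, K u = 1 := by
    have : 𝓕⁻ (K : ℝ → ℂ) 0 = 1 := by
      rw [← SchwartzMap.fourierInv_coe, hKdef, FourierTransform.fourierInv_fourier_eq, hψ0]
    simpa [Real.fourierInv_eq] using this
  set I0 := ∫ u, ‖K u‖
  set I1 := ∫ u, |u| * ‖K u‖
  have hI1 : 0 ≤ I1 := integral_nonneg fun u => by positivity
  rw [Metric.tendsto_atTop']
  suffices ∀ η > 0, ∀ᶠ y in atTop, ‖B y‖ < η by
    intro η hη
    obtain ⟨N, hN⟩ := eventually_atTop.mp (this η hη)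
    exact ⟨N, fun n hn => by simpa using hN n hn.le⟩
  intro η hη
  -- The kernel is made narrow enough that the Lipschitz part of the oscillation costs less than
  -- η/3.
  obtain ⟨r, hr, hrη⟩ : ∃ r : ℝ, 0 < r ∧ D / r * I1 < η / 3 := by
    refine ⟨3 * (D * I1 + 1) / η, by positivity, ?_⟩
    rw [div_mul_eq_mul_div, div_lt_iff₀ (by positivity)]
    field_simp
    linarith
  have hlim := tendsto_integral_comp_add_div_mul_fourier hBm hB hB0 hG hFG ψ.continuous hψc
    (by rw [hKcoe]; exact hKi) hr
  have hεlim : Tendsto (fun y => ε y * I0) atTop (𝓝 0) := by simpa using hε.mul_const I0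
  filter_upwards [hosc, hεlim.eventually_lt_const (by positivity : (0 : ℝ) < η / 3),
    hlim.norm.eventually_lt_const (by simpa using hη : ‖(0 : ℂ)‖ < η / 3)]
    with y h1 h2 h3
  rw [hKcoe] at h3
  have hBK : Integrable fun u => B (y + u / r) * K u :=
    hKi.bdd_mul (by fun_prop : Measurable fun u => B (y + u / r)).aestronglyMeasurable
      (Eventually.of_forall fun u => hB _)
  have hsplit : B y = (∫ u, (B y - B (y + u / r)) * K u) + ∫ u, B (y + u / r) * K u := by
    rw [← integral_add _ hBK]
    · simp only [← add_mul, sub_add_cancel]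
      rw [integral_const_mul, hint, mul_one]
    · simp only [sub_mul]
      exact (hKi.const_mul _).sub hBK
  have hbound : ‖∫ u, (B y - B (y + u / r)) * K u‖ ≤ D / r * I1 + ε y * I0 := by
    have : D / r * I1 + ε y * I0 = ∫ u, (D / r * (|u| * ‖K u‖) + ε y * ‖K u‖) := by
      rw [integral_add (hK1.const_mul _) (hKi.norm.const_mul _), integral_const_mul,
        integral_const_mul]
    rw [this]
    refine norm_integral_le_of_norm_le ((hK1.const_mul _).add (hKi.norm.const_mul _))
      (Eventually.of_forall fun u => ?_)
    rw [norm_mul, ← mul_assoc, ← add_mul]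
    gcongr
    refine (h1 _).trans_eq ?_
    rw [sub_add_cancel_left, abs_neg, abs_div, abs_of_pos hr]
    ring
  calc ‖B y‖ ≤ ‖∫ u, (B y - B (y + u / r)) * K u‖ + ‖∫ u, B (y + u / r) * K u‖ := by
        conv_lhs => rw [hsplit]
        exact norm_add_le _ _
    _ < η := by linarith

/-! ### Bounds and Laplace transform for the Möbius sums -/

/-- The partial sums of the series `∑ μ(k) / k`. -/
noncomputable def moebiusDivSum (N : ℕ) : ℝ :=
  ∑ k ∈ Finset.Icc 1 N, ((ArithmeticFunction.moebius k : ℤ) : ℝ) / (k : ℝ)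

theorem abs_moebius_cast_le_one (k : ℕ) : |((ArithmeticFunction.moebius k : ℤ) : ℝ)| ≤ 1 := by
  exact_mod_cast ArithmeticFunction.abs_moebius_le_one (n := k)

theorem sum_moebius_mul_div {N : ℕ} (hN : N ≠ 0) :
    ∑ k ∈ Finset.Icc 1 N, ((ArithmeticFunction.moebius k : ℤ) : ℝ) * ((N / k : ℕ) : ℝ) = 1 := by
  have h := ArithmeticFunction.sum_Ioc_mul_zeta_eq_sum ArithmeticFunction.moebius N
  rw [ArithmeticFunction.moebius_mul_coe_zeta] at h
  have h1 : ∑ n ∈ Finset.Ioc 0 N, (1 : ArithmeticFunction ℤ) n = 1 := by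
    simp only [ArithmeticFunction.one_apply]
    rw [Finset.sum_ite_eq' (Finset.Ioc 0 N) 1]
    simp [Nat.one_le_iff_ne_zero, hN]
  rw [h1] at h
  have h2 := congrArg (Int.cast : ℤ → ℝ) h
  push_cast at h2
  rw [show Finset.Icc 1 N = Finset.Ioc 0 N from rfl]
  exact h2.symm

/-- N m_N − 1 = ∑ μ(k){N/k}, a sum of N terms of modulus at most 1. -/
theorem abs_moebiusDivSum_le (N : ℕ) : |moebiusDivSum N| ≤ 2 := by
  rcases eq_or_ne N 0 with rfl | hN
  · simp [moebiusDivSum]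
  have hN0 : (1 : ℝ) ≤ N := by exact_mod_cast Nat.one_le_iff_ne_zero.mpr hN
  have hdiff : |N * moebiusDivSum N - 1| ≤ N := by
    rw [← sum_moebius_mul_div hN, moebiusDivSum, Finset.mul_sum, ← Finset.sum_sub_distrib]
    calc _ ≤ ∑ k ∈ Finset.Icc 1 N, (1 : ℝ) := by
          refine (Finset.abs_sum_le_sum_abs _ _).trans (Finset.sum_le_sum fun k hk => ?_)
          have hk0 : (0 : ℝ) < k := by exact_mod_cast (Finset.mem_Icc.mp hk).1
          rw [show (N : ℝ) * (((ArithmeticFunction.moebius k : ℤ) : ℝ) / k) -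
            ((ArithmeticFunction.moebius k : ℤ) : ℝ) * ((N / k : ℕ) : ℝ) =
            ((ArithmeticFunction.moebius k : ℤ) : ℝ) * ((N : ℝ) / k - ((N / k : ℕ) : ℝ)) by ring,
            abs_mul]
          refine mul_le_one₀ (abs_moebius_cast_le_one k) (abs_nonneg _) ?_
          have h1 : ((N / k : ℕ) : ℝ) ≤ (N : ℝ) / k := Nat.cast_div_le
          have h2 : (N : ℝ) / k < ((N / k : ℕ) : ℝ) + 1 := by
            rw [← Nat.floor_div_eq_div (K := ℝ)]
            exact Nat.lt_floor_add_one _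
          rw [abs_of_nonneg (by linarith)]
          linarith
      _ = N := by simp
  have : |N * moebiusDivSum N| ≤ N * 2 := by
    have := abs_add_le (N * moebiusDivSum N - 1) 1
    rw [sub_add_cancel, abs_one] at this
    linarith
  rw [abs_mul, Nat.abs_cast] at this
  exact le_of_mul_le_mul_left this (by linarith)

theorem abs_moebiusDivSum_sub_le {a b : ℕ} (ha : 1 ≤ a) (hab : a ≤ b) :
    |moebiusDivSum b - moebiusDivSum a| ≤ Real.log b - Real.log a := by
  have h1 : |moebiusDivSum b - moebiusDivSum a| ≤ (harmonic b : ℝ) - harmonic a := by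
    induction b, hab using Nat.le_induction with
    | base => simp
    | succ n hn ih =>
      have hs : moebiusDivSum (n + 1) = moebiusDivSum n +
          ((ArithmeticFunction.moebius (n + 1) : ℤ) : ℝ) / ((n + 1 : ℕ) : ℝ) := by
        rw [moebiusDivSum, Finset.sum_Icc_succ_top (by omega)]
        rfl
      have hstep : |((ArithmeticFunction.moebius (n + 1) : ℤ) : ℝ) / ((n + 1 : ℕ) : ℝ)| ≤
          ((n + 1 : ℕ) : ℝ)⁻¹ := by
        rw [abs_div, Nat.abs_cast, div_eq_mul_inv]
        exact mul_le_of_le_one_left (by positivity) (abs_moebius_cast_le_one _)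
      rw [hs, harmonic_succ, add_sub_right_comm]
      refine (abs_add_le _ _).trans ?_
      push_cast at hstep ⊢
      linarith
  -- H_n − log n decreases, so harmonic increments are at most logarithmic ones.
  have h2 := Real.strictAnti_eulerMascheroniSeq'.antitone hab
  rw [Real.eulerMascheroniSeq', Real.eulerMascheroniSeq', if_neg (by omega),
    if_neg (by omega)] at h2
  linarith

theorem abs_moebiusDivSum_floor_exp_sub_le {y z : ℝ} (hz : 0 ≤ z) (hzy : z ≤ y) :
    |moebiusDivSum ⌊Real.exp y⌋₊ - moebiusDivSum ⌊Real.exp z⌋₊| ≤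
      y - z + 2 * Real.exp (-z) := by
  have hz1 : 1 ≤ Real.exp z := Real.one_le_exp hz
  have ha : 1 ≤ ⌊Real.exp z⌋₊ := (Nat.one_le_floor_iff _).mpr hz1
  have hab : ⌊Real.exp z⌋₊ ≤ ⌊Real.exp y⌋₊ := Nat.floor_le_floor (Real.exp_le_exp.mpr hzy)
  have ha' : (1 : ℝ) ≤ ⌊Real.exp z⌋₊ := by exact_mod_cast ha
  have hb' : (1 : ℝ) ≤ ⌊Real.exp y⌋₊ := by exact_mod_cast ha.trans hab
  have hlt := Nat.lt_floor_add_one (Real.exp z)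
  refine (abs_moebiusDivSum_sub_le ha hab).trans ?_
  have h1 : Real.log ⌊Real.exp y⌋₊ ≤ y := by
    rw [Real.log_le_iff_le_exp (by linarith)]
    exact Nat.floor_le (Real.exp_pos _).le
  have h2 : z - Real.log ⌊Real.exp z⌋₊ ≤ 2 * Real.exp (-z) := by
    have h3 : Real.log (Real.exp z / ⌊Real.exp z⌋₊) = z - Real.log ⌊Real.exp z⌋₊ := by
      rw [Real.log_div (Real.exp_pos _).ne' (by linarith), Real.log_exp]
    rw [← h3]
    refine (Real.log_le_sub_one_of_pos (by positivity)).trans ?_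
    rw [Real.exp_neg, ← div_eq_mul_inv, div_sub_one (by linarith),
      div_le_div_iff₀ (by linarith) (by linarith)]
    nlinarith
  linarith

theorem abs_moebiusDivSum_floor_exp_sub_le_of_two_le {y : ℝ} (hy : 2 ≤ y) (z : ℝ) :
    |moebiusDivSum ⌊Real.exp y⌋₊ - moebiusDivSum ⌊Real.exp z⌋₊| ≤
      4 * |y - z| + 2 * Real.exp (-(y / 2)) := by
  have hpos := Real.exp_pos (-(y / 2))
  rcases lt_or_ge z (y / 2) with hz | hz
  -- Here y − z > y/2 ≥ 1, so 4|y − z| exceeds the trivial bound 2 + 2.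
  · have h1 := abs_moebiusDivSum_le ⌊Real.exp y⌋₊
    have h2 := abs_moebiusDivSum_le ⌊Real.exp z⌋₊
    have h3 := abs_sub (moebiusDivSum ⌊Real.exp y⌋₊) (moebiusDivSum ⌊Real.exp z⌋₊)
    have h4 := le_abs_self (y - z)
    linarith
  · rcases le_total z y with hzy | hzy
    · have h1 := abs_moebiusDivSum_floor_exp_sub_le (by linarith) hzy
      have h2 : Real.exp (-z) ≤ Real.exp (-(y / 2)) := Real.exp_le_exp.mpr (by linarith)
      rw [abs_of_nonneg (sub_nonneg.mpr hzy)]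
      linarith
    · have h1 := abs_moebiusDivSum_floor_exp_sub_le (by linarith) hzy
      have h2 : Real.exp (-y) ≤ Real.exp (-(y / 2)) := Real.exp_le_exp.mpr (by linarith)
      rw [abs_sub_comm, abs_sub_comm y z, abs_of_nonneg (sub_nonneg.mpr hzy)]
      linarith

theorem LSeries.term_div_natCast (f : ℕ → ℂ) (s : ℂ) :
    LSeries.term (fun n => f n / n) s = LSeries.term f (s + 1) := by
  ext n
  rcases eq_or_ne n 0 with rfl | hn
  · simp
  · rw [LSeries.term_of_ne_zero hn, LSeries.term_of_ne_zero hn,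
      Complex.cpow_add _ _ (Nat.cast_ne_zero.mpr hn), Complex.cpow_one, div_div, mul_comm]

/-- Abel summation of ∑ μ(n) n^(-s-1) = 1/ζ(s+1). -/
theorem mellin_moebiusDivSum_neg {s : ℂ} (hs : 0 < s.re) :
    mellin (fun t : ℝ => (moebiusDivSum ⌊t⌋₊ : ℂ)) (-s) = (s * riemannZeta (s + 1))⁻¹ := by
  have hcast (n : ℕ) : ∑ k ∈ Finset.Icc 1 n, ((ArithmeticFunction.moebius k : ℤ) : ℂ) / k =
      (moebiusDivSum n : ℂ) := by simp [moebiusDivSum]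
  have hL := LSeries_eq_mul_integral
    (fun n => ((ArithmeticFunction.moebius n : ℤ) : ℂ) / n) le_rfl hs
    (by
      rw [LSeriesSummable, LSeries.term_div_natCast]
      exact ArithmeticFunction.LSeriesSummable_moebius_iff.mpr (by simpa using hs)) (by
      simp only [hcast, Real.rpow_zero]
      refine Asymptotics.isBigO_of_le' (c := 2) _ fun n => ?_
      simpa using abs_moebiusDivSum_le n)
  simp only [hcast] at hL
  have hone : riemannZeta (s + 1) *
      LSeries (fun n => ((ArithmeticFunction.moebius n : ℤ) : ℂ)) (s + 1) = 1 := by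
    have h1 : 1 < (s + 1).re := by simpa using hs
    rw [← LSeries_one_eq_riemannZeta h1]
    exact LSeries_one_mul_Lseries_moebius h1
  rw [LSeries, ← LSeries.term_div_natCast, ← LSeries, hL] at hone
  have hm : mellin (fun t : ℝ => (moebiusDivSum ⌊t⌋₊ : ℂ)) (-s) =
      ∫ t in Set.Ioi (1 : ℝ), (moebiusDivSum ⌊t⌋₊ : ℂ) * (t : ℂ) ^ (-(s + 1)) := by
    rw [mellin, ← integral_Ici_eq_integral_Ioi (x := (1 : ℝ))]
    rw [setIntegral_eq_of_subset_of_forall_sdiff_eq_zero measurableSet_Ioi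
      (s := Set.Ici (1 : ℝ)) (Set.Ici_subset_Ioi.mpr one_pos)]
    · refine integral_congr_ae (Eventually.of_forall fun t => ?_)
      simp only [smul_eq_mul]
      rw [mul_comm, neg_add']
    · rintro t ⟨ht0, ht1⟩
      have : ⌊t⌋₊ = 0 := Nat.floor_eq_zero.mpr (not_le.mp ht1)
      simp [this, moebiusDivSum]
  rw [hm]
  refine eq_inv_of_mul_eq_one_left ?_
  linear_combination hone

/-- The substitution t = e^(-u) turns the Mellin transform into a Fourier transform.
`LFunctionTrivChar₁ 1` at s + 1 is s ζ(s+1) with the singularity at s = 0 filled in. -/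
theorem fourier_moebiusDivSum {σ : ℝ} (hσ : 0 < σ) (ξ : ℝ) :
    𝓕 (fun u : ℝ => Real.exp (-σ * u) • (moebiusDivSum ⌊Real.exp u⌋₊ : ℂ)) ξ =
      (DirichletCharacter.LFunctionTrivChar₁ 1
        (σ + 2 * Real.pi * ξ * Complex.I + 1))⁻¹ := by
  set s : ℂ := σ + 2 * Real.pi * ξ * Complex.I with hsdef
  have hre : s.re = σ := by simp [hsdef]
  have him : s.im = 2 * Real.pi * ξ := by simp [hsdef]
  have hs0 : s + 1 ≠ 1 := fun h => by
    have : s.re = 0 := by simp [add_eq_right.mp h]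
    linarith
  have h := mellin_eq_fourier (fun t : ℝ => (moebiusDivSum ⌊t⁻¹⌋₊ : ℂ)) (s := s)
  rw [mellin_comp_inv (fun t : ℝ => (moebiusDivSum ⌊t⌋₊ : ℂ)) s,
    mellin_moebiusDivSum_neg (by rwa [hre]), hre, him,
    mul_div_cancel_left₀ _ (by positivity)] at h
  simp only [Real.exp_neg, inv_inv] at h
  rw [DirichletCharacter.LFunctionTrivChar₁, Function.update_of_ne hs0,
    DirichletCharacter.LFunctionTrivChar, DirichletCharacter.LFunction_modOne_eq,
    add_sub_cancel_right, h]

theorem continuousOn_inv_LFunctionTrivChar₁_add_one :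
    ContinuousOn (fun s : ℂ => (DirichletCharacter.LFunctionTrivChar₁ 1 (s + 1))⁻¹)
      {s | 0 ≤ s.re} := by
  refine ContinuousOn.inv₀ ((DirichletCharacter.differentiable_LFunctionTrivChar₁
    1).continuous.comp (by fun_prop)).continuousOn fun s hs => ?_
  rcases eq_or_ne s 0 with rfl | hs0
  · rw [zero_add]
    exact DirichletCharacter.LFunctionTrivChar₁_apply_one_ne_zero 1
  · rw [DirichletCharacter.LFunctionTrivChar₁, Function.update_of_ne (by simpa using hs0),
      DirichletCharacter.LFunctionTrivChar, DirichletCharacter.LFunction_modOne_eq,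
    add_sub_cancel_right]
    exact mul_ne_zero hs0 (riemannZeta_ne_zero_of_one_le_re (by simpa using hs))

theorem tendsto_moebiusDivSum : Tendsto moebiusDivSum atTop (𝓝 0) := by
  have hB : Tendsto (fun u : ℝ => (moebiusDivSum ⌊Real.exp u⌋₊ : ℂ)) atTop (𝓝 0) := by
    refine tendsto_zero_of_laplace_continuousOn (C := 2) ?_ (fun x => ?_) (fun x hx => ?_)
      continuousOn_inv_LFunctionTrivChar₁_add_one (fun σ hσ ξ => fourier_moebiusDivSum hσ ξ)
      (D := 4) (by norm_num) (ε := fun y => 2 * Real.exp (-(y / 2))) ?_ ?_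
    · exact Complex.measurable_ofReal.comp ((measurable_from_nat (f := moebiusDivSum)).comp
        (Nat.measurable_floor.comp Real.measurable_exp))
    · simpa using abs_moebiusDivSum_le _
    · have : ⌊Real.exp x⌋₊ = 0 := Nat.floor_eq_zero.mpr (by simpa using hx)
      simp [this, moebiusDivSum]
    · have : Tendsto (fun y : ℝ => Real.exp (-(y / 2))) atTop (𝓝 0) :=
        Real.tendsto_exp_neg_atTop_nhds_zero.comp (tendsto_id.atTop_div_const two_pos)
      simpa using this.const_mul 2
    · filter_upwards [eventually_ge_atTop 2] with y hy z
      rw [← Complex.ofReal_sub, Complex.norm_real]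
      exact abs_moebiusDivSum_floor_exp_sub_le_of_two_le hy z
  have hlog : Tendsto (fun n : ℕ => Real.log n) atTop atTop :=
    Real.tendsto_log_atTop.comp tendsto_natCast_atTop_atTop
  have h := hB.comp hlog
  rw [← Complex.ofReal_zero] at h
  refine (Complex.continuous_re.tendsto _ |>.comp h).congr' ?_
  filter_upwards [eventually_gt_atTop 0] with n hn
  simp [Real.exp_log (Nat.cast_pos.mpr hn)]

/-! ### The product over primes -/

theorem hasProd_one_sub_one_div_primes :
    HasProd (fun p : Nat.Primes => 1 - 1 / ((p : ℕ) : ℝ)) 0 := by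
  have hsum : Tendsto (fun s : Finset Nat.Primes => ∑ p ∈ s, (1 / ((p : ℕ) : ℝ))) atTop atTop := by
    refine tendsto_atTop_atTop_of_monotone
      (fun s t hst => Finset.sum_le_sum_of_subset_of_nonneg hst fun _ _ _ => by positivity) ?_
    by_contra! h
    obtain ⟨b, hb⟩ := h
    exact Nat.Primes.not_summable_one_div
      (summable_of_sum_le (fun p => by positivity) fun s => (hb s).le)
  have hnonneg (p : Nat.Primes) : 0 ≤ 1 - 1 / ((p : ℕ) : ℝ) := by
    rw [sub_nonneg, div_le_one (by exact_mod_cast p.2.pos)]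
    exact_mod_cast p.2.one_le
  rw [HasProd, SummationFilter.unconditional_filter]
  -- By 1 − x ≤ e^(-x), each finite product is at most exp(−∑ 1/p).
  refine squeeze_zero (fun s => Finset.prod_nonneg fun p _ => hnonneg p) (fun s => ?_)
    (Real.tendsto_exp_neg_atTop_nhds_zero.comp hsum)
  rw [Function.comp_apply, ← Finset.sum_neg_distrib, Real.exp_sum]
  exact Finset.prod_le_prod (fun p _ => hnonneg p) fun p _ => Real.one_sub_le_exp_neg _

theorem mainTheorem1 :
    Tendsto (fun N : ℕ => ∑ k ∈ Finset.Icc 1 N, ((ArithmeticFunction.moebius k : ℤ) : ℝ) / (k : ℝ))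
        atTop (𝓝 (∏' p : Nat.Primes, (1 - 1 / ((p : ℕ) : ℝ)))) ∧
      HasProd (fun p : Nat.Primes => 1 - 1 / ((p : ℕ) : ℝ)) 0 := by
  refine ⟨?_, hasProd_one_sub_one_div_primes⟩
  rw [hasProd_one_sub_one_div_primes.tprod_eq]
  exact tendsto_moebiusDivSum
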